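/- Let $R$ be an integral domain with quotient field $K$, and let $\mathbf{F}(R)$ be the set of all $R$-submodules of $K$. A semistar operation on $R$ is a map $\star:\mathbf{F}(R)\to\mathbf{F}(R)$, $I\mapsto I^\star$, such that for all $I,J\in\mathbf{F}(R)$ and $x\in K$: $I\subseteq I^\star$; $(I^\star)^\star=I^\star$; $I\subseteq J$ implies $I^\star\subseteq J^\star$; and $(xI)^\star=x\,I^\star$. It is a (semi)star operation if $R^\star=R$, and it is stable if $(I\cap J)^\star=I^\star\cap J^\star$ for all $I,J\in\mathbf{F}(R)$. The quasi-spectrum $\operatorname{QSpec}^\star(R)$ is the set of prime ideals $P$ of $R$ with $P^\star\cap R=P$. The pseudo-spectrum $\operatorname{PsSpec}^\star(R)$ is the set of prime ideals $P$ of $R$ such that $P^\star\cap R=R$ and $L^\star\cap R=L$ for some $P$-primary ideal $L$ of $R$. The normalized stable version of $\star$ is the semistar operation $\overline{\star}$ defined by $$I^{\overline{\star}}:=\bigcap_{P\in\operatorname{QSpec}^\star(R)}IR_P\ \cap\bigcap_{P\in\operatorname{PsSpec}^\star(R)}(IR_P)^{v_{R_P}}\qquad(I\in\mathbf{F}(R)),$$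 where an empty intersection is $K$, $J^{v_{R_P}}=(R_P:(R_P:J))$ and $(A:B)=\{x\in K\mid xB\subseteq A\}$. **Proposition.** Let $R$ be a Prüfer domain (a domain in which every nonzero finitely generated ideal is invertible), and let $\star$ be a stable (semi)star operation on $R$. If $\operatorname{Spec}(R)\setminus\operatorname{QSpec}^\star(R)$, with the subspace topology of the Zariski topology on $\operatorname{Spec}(R)$, is a Noetherian space, then $\star=\overline{\star}$, that is, $I^\star=I^{\overline{\star}}$ for every $R$-submodule $I$ of $K$. -/

import Mathlib

open scoped Pointwise nonZeroDivisors

/-- A Prüfer domain: every nonzero finitely generated ideal is invertible. -/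
def IsPruferDomain (R : Type*) [CommRing R] [IsDomain R] : Prop :=
  ∀ I : Ideal R, I.FG → I ≠ ⊥ → IsUnit (I : FractionalIdeal R⁰ (FractionRing R))

/-- A semistar operation on a domain `R` with quotient field `K`. -/
@[ext]
structure SemistarOperation (R K : Type*) [CommRing R] [Field K] [Algebra R K] where
  /-- The underlying map `I ↦ I^⋆` on the `R`-submodules of `K`. -/
  toFun : Submodule R K → Submodule R K
  le_apply' : ∀ I, I ≤ toFun I
  idem' : ∀ I, toFun (toFun I) = toFun I
  mono' : ∀ I J, I ≤ J → toFun I ≤ toFun J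
  smul' : ∀ (x : K) (I : Submodule R K), toFun (x • I) = x • toFun I

section LocalModules

variable {R K : Type*} [CommRing R] [IsDomain R] [Field K] [Algebra R K] [IsFractionRing R K]

variable (K) in
/-- The localization `R_P`, as an `R`-submodule of the quotient field `K`. -/
noncomputable def localRing (P : PrimeSpectrum R) : Submodule R K :=
  Subalgebra.toSubmodule (Localization.subalgebra.ofField K P.asIdeal.primeCompl
    (Ideal.primeCompl_le_nonZeroDivisors P.asIdeal))

/-- The extension `I R_P` of an `R`-submodule `I` of `K`. -/
noncomputable def localExt (P : PrimeSpectrum R) (I : Submodule R K) : Submodule R K :=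
  I * localRing K P

/-- `(I R_P)^v = (R_P : (R_P : I R_P))`, where `v` is the `v`-operation of `R_P`; the quotient
`A / B` of submodules of `K` is the colon `(A : B) = {x ∈ K | x B ⊆ A}`. -/
noncomputable def localV (P : PrimeSpectrum R) (I : Submodule R K) : Submodule R K :=
  localRing K P / (localRing K P / localExt P I)

theorem localRing_mul_self (P : PrimeSpectrum R) :
    localRing K P * localRing K P = localRing K P :=
  Subalgebra.isIdempotentElem_toSubmodule _

theorem le_localExt (P : PrimeSpectrum R) (I : Submodule R K) : I ≤ localExt P I := by
  intro x hx
  have h := Submodule.mul_mem_mul hx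
    (show (1 : K) ∈ localRing K P from Subalgebra.one_mem _)
  rwa [mul_one] at h

theorem localExt_mono (P : PrimeSpectrum R) {I J : Submodule R K} (h : I ≤ J) :
    localExt P I ≤ localExt P J :=
  mul_le_mul_left h _

theorem localExt_idem (P : PrimeSpectrum R) (I : Submodule R K) :
    localExt P (localExt P I) = localExt P I := by
  rw [localExt, localExt, mul_assoc, localRing_mul_self]

theorem localExt_smul (P : PrimeSpectrum R) (x : K) (I : Submodule R K) :
    localExt P (x • I) = x • localExt P I := by
  rw [localExt, localExt, smul_mul_assoc]

theorem mem_localV {P : PrimeSpectrum R} {I : Submodule R K} {x : K} :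
    x ∈ localV P I ↔
      ∀ y, (∀ z ∈ localExt P I, y * z ∈ localRing K P) → x * y ∈ localRing K P := by
  simp only [localV, Submodule.mem_div_iff_forall_mul_mem]

theorem localExt_le_localV (P : PrimeSpectrum R) (I : Submodule R K) :
    localExt P I ≤ localV P I := by
  intro x hx
  rw [mem_localV]
  intro y hy
  rw [mul_comm]
  exact hy x hx

theorem localV_mono (P : PrimeSpectrum R) {I J : Submodule R K} (h : I ≤ J) :
    localV P I ≤ localV P J := by
  intro x hx
  rw [mem_localV] at hx ⊢
  exact fun y hy => hx y fun z hz => hy z (localExt_mono P h hz)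

theorem localV_idem_le (P : PrimeSpectrum R) (I : Submodule R K) :
    localV P (localV P I) ≤ localV P I := by
  intro x hx
  rw [mem_localV] at hx ⊢
  intro y hy
  refine hx y fun z hz => ?_
  refine Submodule.mul_induction_on hz (fun a ha b hb => ?_) (fun a b ha hb => ?_)
  · have h1 := Submodule.mul_mem_mul ((mem_localV.1 ha) y hy) hb
    rw [localRing_mul_self] at h1
    have h2 : y * (a * b) = a * y * b := by ring
    rwa [h2]
  · rw [mul_add]
    exact add_mem ha hb

theorem localV_smul_le (P : PrimeSpectrum R) {x : K} (hx : x ≠ 0) (I : Submodule R K) :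
    localV P (x • I) ≤ x • localV P I := by
  intro w hw
  rw [mem_localV] at hw
  have h : x⁻¹ * w ∈ localV P I := by
    rw [mem_localV]
    intro y hy
    have h1 := hw (x⁻¹ * y) (fun z hz => by
      rw [localExt_smul] at hz
      obtain ⟨t, ht, rfl⟩ := (Submodule.mem_smul_pointwise_iff_exists _ _ _).1 hz
      have h2 : x⁻¹ * y * (x • t) = y * t := by
        rw [smul_eq_mul]; field_simp
      rw [h2]
      exact hy t ht)
    have h3 : x⁻¹ * w * y = w * (x⁻¹ * y) := by ring
    rwa [h3]
  have h4 := Submodule.smul_mem_pointwise_smul _ x _ h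
  rwa [smul_eq_mul, mul_inv_cancel_left₀ hx] at h4

end LocalModules

namespace SemistarOperation

section Basic

variable {R K : Type*} [CommRing R] [Field K] [Algebra R K]

instance : CoeFun (SemistarOperation R K) (fun _ => Submodule R K → Submodule R K) :=
  ⟨SemistarOperation.toFun⟩

/-- A (semi)star operation is a semistar operation with `R^⋆ = R`; here `1` is `R` as a
submodule of `K`. -/
def IsSemiStar (σ : SemistarOperation R K) : Prop :=
  σ (1 : Submodule R K) = 1

/-- Stable operations: `(I ∩ J)^⋆ = I^⋆ ∩ J^⋆`. -/
def IsStable (σ : SemistarOperation R K) : Prop :=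
  ∀ I J : Submodule R K, σ (I ⊓ J) = σ I ⊓ σ J

/-- The ideal `I^⋆ ∩ R` of `R`, for an ideal `I` of `R`. -/
def contract (σ : SemistarOperation R K) (I : Ideal R) : Ideal R :=
  (σ (IsLocalization.coeSubmodule K I)).comap (Algebra.linearMap R K)

/-- An ideal `I` of `R` is quasi-`⋆`-closed if `I = I^⋆ ∩ R`. -/
def IsQuasiClosed (σ : SemistarOperation R K) (I : Ideal R) : Prop :=
  σ.contract I = I

/-- The quasi-spectrum `QSpec^⋆(R)`. -/
def quasiSpectrum (σ : SemistarOperation R K) : Set (PrimeSpectrum R) :=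
  {P | σ.IsQuasiClosed P.asIdeal}

/-- The pseudo-spectrum: the primes `P` with `P^⋆ ∩ R = R` for which some `P`-primary ideal
is quasi-`⋆`-closed. -/
def pseudoSpectrum (σ : SemistarOperation R K) : Set (PrimeSpectrum R) :=
  {P | σ.contract P.asIdeal = ⊤ ∧
    ∃ L : Ideal R, L.IsPrimary ∧ L.radical = P.asIdeal ∧ σ.IsQuasiClosed L}

theorem apply_bot (σ : SemistarOperation R K) : σ ⊥ = ⊥ := by
  have h := σ.smul' 0 ⊥
  simpa using h

end Basic

variable {R K : Type*} [CommRing R] [IsDomain R] [Field K] [Algebra R K] [IsFractionRing R K]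

theorem bot_mem_quasiSpectrum (σ : SemistarOperation R K) :
    (⊥ : PrimeSpectrum R) ∈ σ.quasiSpectrum := by
  change σ.contract (⊥ : Ideal R) = ⊥
  rw [contract, IsLocalization.coeSubmodule_bot, apply_bot, Submodule.comap_bot, LinearMap.ker_eq_bot]
  exact IsFractionRing.injective R K

/-- The map `I ↦ ⋂_{P ∈ QSpec} I R_P ∩ ⋂_{P ∈ PsSpec} (I R_P)^v`. -/
noncomputable def normalizedFun (σ : SemistarOperation R K) (I : Submodule R K) :
    Submodule R K :=
  (⨅ P ∈ σ.quasiSpectrum, localExt P I) ⊓ (⨅ P ∈ σ.pseudoSpectrum, localV P I)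

theorem mem_normalizedFun (σ : SemistarOperation R K) (I : Submodule R K) (x : K) :
    x ∈ σ.normalizedFun I ↔ (∀ P ∈ σ.quasiSpectrum, x ∈ localExt P I) ∧
      ∀ P ∈ σ.pseudoSpectrum, x ∈ localV P I := by
  simp only [normalizedFun, Submodule.mem_inf, Submodule.mem_iInf]

theorem normalizedFun_smul_le (σ : SemistarOperation R K) {x : K} (hx : x ≠ 0)
    (I : Submodule R K) : σ.normalizedFun (x • I) ≤ x • σ.normalizedFun I := by
  intro w hw
  rw [mem_normalizedFun] at hw
  have key : ∀ J : Submodule R K, w ∈ x • J → x⁻¹ * w ∈ J := by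
    intro J hJ
    obtain ⟨t, ht, rfl⟩ := (Submodule.mem_smul_pointwise_iff_exists _ _ _).1 hJ
    rwa [smul_eq_mul, inv_mul_cancel_left₀ hx]
  have h : x⁻¹ * w ∈ σ.normalizedFun I := by
    rw [mem_normalizedFun]
    refine ⟨fun P hP => key _ ?_, fun P hP => key _ (localV_smul_le P hx I (hw.2 P hP))⟩
    rw [← localExt_smul]
    exact hw.1 P hP
  have h4 := Submodule.smul_mem_pointwise_smul _ x _ h
  rwa [smul_eq_mul, mul_inv_cancel_left₀ hx] at h4

/-- The normalized stable version of `⋆`, as a semistar operation. -/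
noncomputable def normalizedStable (σ : SemistarOperation R K) : SemistarOperation R K where
  toFun := σ.normalizedFun
  le_apply' I := by
    intro x hx
    rw [mem_normalizedFun]
    exact ⟨fun P _ => le_localExt P I hx,
      fun P _ => localExt_le_localV P I (le_localExt P I hx)⟩
  idem' I := by
    apply le_antisymm
    · intro x hx
      rw [mem_normalizedFun] at hx ⊢
      refine ⟨fun P hP => ?_, fun P hP => ?_⟩
      · rw [← localExt_idem]
        exact localExt_mono P (fun y hy => ((mem_normalizedFun σ I y).1 hy).1 P hP) (hx.1 P hP)
      · exact localV_idem_le P I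
          (localV_mono P (fun y hy => ((mem_normalizedFun σ I y).1 hy).2 P hP) (hx.2 P hP))
    · intro x hx
      rw [mem_normalizedFun]
      exact ⟨fun P _ => le_localExt P _ hx,
        fun P _ => localExt_le_localV P _ (le_localExt P _ hx)⟩
  mono' I J h := by
    intro x hx
    rw [mem_normalizedFun] at hx ⊢
    exact ⟨fun P hP => localExt_mono P h (hx.1 P hP), fun P hP => localV_mono P h (hx.2 P hP)⟩
  smul' x I := by
    by_cases hx : x = 0
    · subst hx
      have h0 : ∀ J : Submodule R K, (0 : K) • J = ⊥ := by
        intro J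
        rw [eq_bot_iff]
        intro y hy
        obtain ⟨t, _, rfl⟩ := (Submodule.mem_smul_pointwise_iff_exists _ _ _).1 hy
        simp
      rw [h0, h0, eq_bot_iff]
      intro y hy
      have h := ((mem_normalizedFun σ _ y).1 hy).1 ⊥ σ.bot_mem_quasiSpectrum
      rwa [localExt, Submodule.bot_mul] at h
    · apply le_antisymm (σ.normalizedFun_smul_le hx I)
      have h := σ.normalizedFun_smul_le (inv_ne_zero hx) (x • I)
      rw [smul_smul, inv_mul_cancel₀ hx, one_smul] at h
      intro y hy
      obtain ⟨t, ht, rfl⟩ := (Submodule.mem_smul_pointwise_iff_exists _ _ _).1 hy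
      obtain ⟨u, hu, rfl⟩ := (Submodule.mem_smul_pointwise_iff_exists _ _ _).1 (h ht)
      rwa [smul_smul, mul_inv_cancel₀ hx, one_smul]

end SemistarOperation

/-! Call an ideal `I` `⋆`-dense if `1 ∈ I^⋆`. A stable operation is determined by its dense ideals,
since `x ∈ A^⋆` iff `(A : x)` is dense (`IsStable.mem_iff`). Over a Prüfer domain the normalized
version is stable too, so it suffices that both operations have the same dense ideals.

If `I` is `⋆`-dense, no quasi-`⋆`-closed prime contains it. At a pseudo-spectrum prime `P`, if `(I
R_P)^v` missed `1`, then `I R_P ⊆ a R_P` with `a ∈ P`, and a power of `I`, still dense, would lie in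
the closed `P`-primary ideal `L`.

The converse is Noetherian induction on the trace of `V(I)` outside the quasi-spectrum. For a
minimal prime `P` of `I`, the ideal `I R_P ∩ R` is dense. Each of its elements `x` is multiplied
into `I` by some `s ∉ P`, so `(I : x)` has a smaller trace and is dense by induction; hence so is
`I`. -/

section Basic

variable {R : Type*} [CommRing R]

/-- The saturation `I R_P ∩ R` of an ideal `I` at a prime `P`. -/
def Ideal.saturationAt (P : PrimeSpectrum R) (I : Ideal R) : Ideal R where
  carrier := {r | ∃ s ∉ P.asIdeal, s * r ∈ I}
  zero_mem' := ⟨1, P.isPrime.one_notMem, by simp⟩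
  add_mem' := by
    rintro a b ⟨s, hs, ha⟩ ⟨t, ht, hb⟩
    refine ⟨s * t, fun h => (P.isPrime.mem_or_mem h).elim hs ht, ?_⟩
    have : s * t * (a + b) = t * (s * a) + s * (t * b) := by ring
    rw [this]
    exact add_mem (I.mul_mem_left t ha) (I.mul_mem_left s hb)
  smul_mem' := by
    rintro c a ⟨s, hs, ha⟩
    refine ⟨s, hs, ?_⟩
    rw [smul_eq_mul, mul_left_comm]
    exact I.mul_mem_left c ha

theorem Ideal.mem_saturationAt {P : PrimeSpectrum R} {I : Ideal R} {r : R} :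
    r ∈ I.saturationAt P ↔ ∃ s ∉ P.asIdeal, s * r ∈ I := Iff.rfl

theorem algebraMap_mem_coeSubmodule {K : Type*} [CommRing K] [Algebra R K] [IsFractionRing R K]
    {I : Ideal R} {r : R} :
    algebraMap R K r ∈ IsLocalization.coeSubmodule K I ↔ r ∈ I := by
  rw [IsLocalization.mem_coeSubmodule]
  constructor
  · rintro ⟨y, hy, h⟩
    rwa [← IsFractionRing.injective R K h]
  · exact fun h => ⟨r, h, rfl⟩

end Basic

/-! ### Localizations of a Prüfer domain as valuation rings -/

section LocalModules

variable {R K : Type*} [CommRing R] [IsDomain R] [Field K] [Algebra R K] [IsFractionRing R K]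

theorem mem_localRing {P : PrimeSpectrum R} {x : K} :
    x ∈ localRing K P ↔ ∃ s ∉ P.asIdeal, ∃ r : R, s • x = algebraMap R K r := by
  have h0 : x ∈ localRing K P ↔ ∃ (a s : R) (_ : s ∈ P.asIdeal.primeCompl),
    x = algebraMap R K a * (algebraMap R K s)⁻¹ := Iff.rfl
  have hne : ∀ s ∉ P.asIdeal, algebraMap R K s ≠ 0 := fun s hs h =>
    hs ((IsFractionRing.injective R K (h.trans (map_zero _).symm)) ▸ P.asIdeal.zero_mem)
  rw [h0]
  constructor
  · rintro ⟨a, s, hs, rfl⟩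
    refine ⟨s, hs, a, ?_⟩
    have := hne s hs
    rw [Algebra.smul_def]
    field_simp
  · rintro ⟨s, hs, r, h⟩
    refine ⟨r, s, hs, ?_⟩
    have := hne s hs
    rw [← h, Algebra.smul_def]
    field_simp

theorem mem_localExt {P : PrimeSpectrum R} {I : Submodule R K} {x : K} :
    x ∈ localExt P I ↔ ∃ s ∉ P.asIdeal, s • x ∈ I := by
  constructor
  · intro hx
    refine Submodule.mul_induction_on hx (fun a ha b hb => ?_) ?_
    · obtain ⟨s, hs, r, h⟩ := mem_localRing.1 hb
      refine ⟨s, hs, ?_⟩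
      rw [← mul_smul_comm, h, mul_comm, ← Algebra.smul_def]
      exact I.smul_mem r ha
    · rintro a b ⟨s, hs, ha⟩ ⟨t, ht, hb⟩
      refine ⟨s * t, fun h => (P.isPrime.mem_or_mem h).elim hs ht, ?_⟩
      rw [smul_add, mul_comm, mul_smul, mul_comm, mul_smul]
      exact add_mem (I.smul_mem t ha) (I.smul_mem s hb)
  · rintro ⟨s, hs, h⟩
    have hs0 : algebraMap R K s ≠ 0 := fun h =>
      hs ((IsFractionRing.injective R K (h.trans (map_zero _).symm)) ▸ P.asIdeal.zero_mem)
    have hinv : (algebraMap R K s)⁻¹ ∈ localRing K P :=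
      mem_localRing.2 ⟨s, hs, 1, by rw [Algebra.smul_def, mul_inv_cancel₀ hs0, map_one]⟩
    have := Submodule.mul_mem_mul h hinv
    rwa [Algebra.smul_def, mul_right_comm, mul_inv_cancel₀ hs0, one_mul] at this

theorem mul_mem_localExt {P : PrimeSpectrum R} {I : Submodule R K} {x y : K}
    (hx : x ∈ localExt P I) (hy : y ∈ localRing K P) : x * y ∈ localExt P I := by
  have := Submodule.mul_mem_mul hx hy
  rwa [localExt, mul_assoc, localRing_mul_self] at this

theorem localExt_inf (P : PrimeSpectrum R) (I J : Submodule R K) :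
    localExt P (I ⊓ J) = localExt P I ⊓ localExt P J := by
  refine le_antisymm (le_inf (localExt_mono P inf_le_left) (localExt_mono P inf_le_right)) ?_
  rintro x ⟨hI, hJ⟩
  obtain ⟨s, hs, hI⟩ := mem_localExt.1 hI
  obtain ⟨t, ht, hJ⟩ := mem_localExt.1 hJ
  refine mem_localExt.2 ⟨s * t, fun h => (P.isPrime.mem_or_mem h).elim hs ht, ?_, ?_⟩
  · rw [mul_comm, mul_smul]
    exact I.smul_mem t hI
  · rw [mul_smul]
    exact J.smul_mem s hJ

theorem inv_notMem_localRing {P : PrimeSpectrum R} {a : R} (ha : a ∈ P.asIdeal) (h0 : a ≠ 0) :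
    (algebraMap R K a)⁻¹ ∉ localRing K P := by
  intro h
  obtain ⟨s, hs, r, h⟩ := mem_localRing.1 h
  have hne : algebraMap R K a ≠ 0 := fun h =>
    h0 (IsFractionRing.injective R K (h.trans (map_zero _).symm))
  have h1 : algebraMap R K s = algebraMap R K (r * a) := by
    rw [map_mul, ← h, Algebra.smul_def, inv_mul_cancel_right₀ hne]
  rw [IsFractionRing.injective R K h1] at hs
  exact hs (P.asIdeal.mul_mem_left r ha)

/-- In a Prüfer domain a nonzero ideal `(a, b)` is locally principal. -/
theorem IsPruferDomain.exists_local_generator (hR : IsPruferDomain R) {a : R} (ha : a ≠ 0)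
    (b : R) : ∃ p q r s : R, p + s = 1 ∧ p * b = q * a ∧ s * a = r * b := by
  obtain ⟨J, hJ, -⟩ := isUnit_iff_exists.1 <| hR (Ideal.span {a, b}) (Submodule.fg_span (Set.toFinite _)) fun h =>
    ha ((Submodule.eq_bot_iff _).1 h a (Ideal.subset_span (by simp)))
  have hmul : ∀ x ∈ Ideal.span {a, b}, ∀ u ∈ J,
      ∃ p : R, algebraMap R (FractionRing R) p = algebraMap R (FractionRing R) x * u := by
    intro x hx u hu
    have h := FractionalIdeal.mul_mem_mul
      (FractionalIdeal.mem_coeIdeal_of_mem (P := FractionRing R) R⁰ hx) hu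
    rw [hJ] at h
    exact (FractionalIdeal.mem_one_iff R⁰).1 h
  have h1 : (1 : FractionRing R) ∈
      ((Ideal.span {a, b} : Ideal R) : FractionalIdeal R⁰ (FractionRing R)) * J := by
    rw [hJ]
    exact FractionalIdeal.one_mem_one R⁰
  have h2 : ∃ u ∈ J, ∃ v ∈ J, (1 : FractionRing R) =
      algebraMap R (FractionRing R) a * u + algebraMap R (FractionRing R) b * v := by
    refine FractionalIdeal.mul_induction_on h1 (fun i hi j hj => ?_) ?_
    · obtain ⟨x, hx, rfl⟩ := (FractionalIdeal.mem_coeIdeal R⁰).1 hi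
      obtain ⟨c, d, rfl⟩ := Ideal.mem_span_pair.1 hx
      refine ⟨c • j, Submodule.smul_mem (J : Submodule R (FractionRing R)) c hj, d • j,
        Submodule.smul_mem (J : Submodule R (FractionRing R)) d hj, ?_⟩
      simp only [Algebra.smul_def, map_add, map_mul]
      ring
    · rintro x y ⟨u, hu, v, hv, rfl⟩ ⟨u', hu', v', hv', rfl⟩
      exact ⟨u + u', add_mem (S := Submodule R (FractionRing R)) (s := J) hu hu',
        v + v', add_mem (S := Submodule R (FractionRing R)) (s := J) hv hv', by ring⟩
  obtain ⟨u, hu, v, hv, h⟩ := h2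
  have ha' : a ∈ Ideal.span {a, b} := Ideal.subset_span (by simp)
  have hb' : b ∈ Ideal.span {a, b} := Ideal.subset_span (by simp)
  -- The four elements are `au`, `bu`, `av`, `bv`, which lie in `(a, b) J = R`, where `au + bv = 1`.
  obtain ⟨p, hp⟩ := hmul a ha' u hu
  obtain ⟨q, hq⟩ := hmul b hb' u hu
  obtain ⟨r, hr⟩ := hmul a ha' v hv
  obtain ⟨s, hs⟩ := hmul b hb' v hv
  refine ⟨p, q, r, s, ?_, ?_, ?_⟩ <;> apply IsFractionRing.injective R (FractionRing R)
  · rw [map_add, map_one, hp, hs, h]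
  · rw [map_mul, map_mul, hp, hq]
    ring
  · rw [map_mul, map_mul, hr, hs]
    ring

/-- The localizations of a Prüfer domain at its primes are valuation rings. -/
theorem IsPruferDomain.mem_localRing_or_inv_mem (hR : IsPruferDomain R) (P : PrimeSpectrum R)
    (x : K) : x ∈ localRing K P ∨ x⁻¹ ∈ localRing K P := by
  obtain ⟨b, a, ha, rfl⟩ := IsFractionRing.div_surjective R x
  have ha0 : algebraMap R K a ≠ 0 := IsFractionRing.to_map_ne_zero_of_mem_nonZeroDivisors ha
  obtain ⟨p, q, r, s, h1, hb, hc⟩ := hR.exists_local_generator (nonZeroDivisors.ne_zero ha) b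
  have hps : p ∉ P.asIdeal ∨ s ∉ P.asIdeal := by
    by_contra! h
    exact P.isPrime.one_notMem (h1 ▸ add_mem h.1 h.2)
  rcases hps with hp | hs
  · refine Or.inl (mem_localRing.2 ⟨p, hp, q, ?_⟩)
    rw [Algebra.smul_def, ← mul_div_assoc, ← map_mul, hb, map_mul, mul_div_cancel_right₀ _ ha0]
  · by_cases hb0 : algebraMap R K b = 0
    · left
      rw [hb0, zero_div]
      exact zero_mem _
    refine Or.inr (mem_localRing.2 ⟨s, hs, r, ?_⟩)
    rw [inv_div, Algebra.smul_def, ← mul_div_assoc, ← map_mul, hc, map_mul,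
      mul_div_cancel_right₀ _ hb0]

/-- Submodules over a valuation ring form a chain: of `w / z` and `z / w`, one lies in `R_P`. -/
theorem IsPruferDomain.localExt_total (hR : IsPruferDomain R) (P : PrimeSpectrum R)
    (I J : Submodule R K) : localExt P I ≤ localExt P J ∨ localExt P J ≤ localExt P I := by
  by_contra! h
  obtain ⟨z, hzI, hzJ⟩ := SetLike.not_le_iff_exists.1 h.1
  refine h.2 fun w hw => ?_
  by_cases hw0 : w = 0
  · rw [hw0]
    exact zero_mem _
  have hz0 : z ≠ 0 := fun h => hzJ (h ▸ zero_mem _)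
  rcases hR.mem_localRing_or_inv_mem P (w / z) with h1 | h1
  · have := mul_mem_localExt hzI h1
    rwa [mul_div_cancel₀ _ hz0] at this
  · rw [inv_div] at h1
    have := mul_mem_localExt hw h1
    rw [mul_div_cancel₀ _ hw0] at this
    exact absurd this hzJ

/-- The extensions of `I` and `J` are comparable, so the meet is one of them. This is where
stability of the normalized version uses the Prüfer hypothesis. -/
theorem IsPruferDomain.localV_inf (hR : IsPruferDomain R) (P : PrimeSpectrum R)
    (I J : Submodule R K) : localV P (I ⊓ J) = localV P I ⊓ localV P J := by
  refine le_antisymm (le_inf (localV_mono P inf_le_left) (localV_mono P inf_le_right)) ?_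
  rcases hR.localExt_total P I J with h | h
  · refine inf_le_left.trans (le_of_eq ?_)
    rw [localV, localV, localExt_inf, inf_eq_left.2 h]
  · refine inf_le_right.trans (le_of_eq ?_)
    rw [localV, localV, localExt_inf, inf_eq_right.2 h]

/-- If `(I R_P)^v` contains `1`, then `I R_P` contains `P`. -/
theorem IsPruferDomain.mem_localExt_of_one_mem_localV (hR : IsPruferDomain R)
    {P : PrimeSpectrum R} {I : Submodule R K} (h1 : (1 : K) ∈ localV P I) {a : R}
    (ha : a ∈ P.asIdeal) : algebraMap R K a ∈ localExt P I := by
  by_contra hmem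
  have h0 : algebraMap R K a ≠ 0 := fun h => hmem (h ▸ zero_mem _)
  -- If `a ∉ I R_P`, then `I R_P ⊆ a R_P`, so `a⁻¹` maps `I R_P` into `R_P`; testing `1 ∈ (I R_P)^v`
  -- on `a⁻¹` gives `a⁻¹ ∈ R_P`.
  refine inv_notMem_localRing (K := K) ha (fun h => h0 (by rw [h, map_zero])) ?_
  rw [← one_mul (algebraMap R K a)⁻¹]
  refine mem_localV.1 h1 _ fun z hz => ?_
  rcases hR.mem_localRing_or_inv_mem P ((algebraMap R K a)⁻¹ * z) with h | h
  · exact h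
  · by_cases hz0 : z = 0
    · rw [hz0, mul_zero]
      exact zero_mem _
    have := mul_mem_localExt hz h
    rw [mul_inv, inv_inv, mul_left_comm, mul_inv_cancel₀ hz0, mul_one] at this
    exact absurd this hmem

theorem algebraMap_mem_localExt {P : PrimeSpectrum R} {I : Ideal R} {r : R} :
    algebraMap R K r ∈ localExt P (IsLocalization.coeSubmodule K I) ↔
      r ∈ I.saturationAt P := by
  simp_rw [mem_localExt, Ideal.mem_saturationAt, Algebra.smul_def, ← map_mul,
    algebraMap_mem_coeSubmodule]

end LocalModules

/-! ### Dense ideals of a stable operation -/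

namespace SemistarOperation

section Contract

variable {R K : Type*} [CommRing R] [Field K] [Algebra R K] {σ : SemistarOperation R K}

theorem contract_eq_top {I : Ideal R} :
    σ.contract I = ⊤ ↔ (1 : K) ∈ σ (IsLocalization.coeSubmodule K I) := by
  rw [Ideal.eq_top_iff_one, contract, Submodule.mem_comap, Algebra.linearMap_apply, map_one]

theorem contract_mono {I J : Ideal R} (h : I ≤ J) : σ.contract I ≤ σ.contract J :=
  Submodule.comap_mono (σ.mono' _ _ (IsLocalization.coeSubmodule_mono K h))

theorem contract_eq_top_mono {I J : Ideal R} (h : I ≤ J) (hI : σ.contract I = ⊤) :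
    σ.contract J = ⊤ :=
  top_le_iff.1 (hI ▸ contract_mono h)

theorem coeSubmodule_contract_le (I : Ideal R) :
    IsLocalization.coeSubmodule K (σ.contract I) ≤ σ (IsLocalization.coeSubmodule K I) := by
  intro x hx
  obtain ⟨r, hr, rfl⟩ := (IsLocalization.mem_coeSubmodule _ _).1 hx
  exact hr

theorem inv_smul_self_mem {x : K} (hx : x ≠ 0) {A : Submodule R K} :
    1 ∈ x⁻¹ • A ↔ x ∈ A := by
  rw [Submodule.mem_smul_pointwise_iff_exists]
  constructor
  · rintro ⟨a, ha, h⟩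
    rwa [← (inv_mul_eq_one₀ hx).1 h] at ha
  · exact fun h => ⟨x, h, inv_mul_cancel₀ hx⟩

variable [IsFractionRing R K]

theorem le_contract (I : Ideal R) : I ≤ σ.contract I := fun _ hr =>
  σ.le_apply' _ (algebraMap_mem_coeSubmodule.2 hr)

theorem contract_top : σ.contract (⊤ : Ideal R) = ⊤ := top_le_iff.1 (le_contract ⊤)

theorem contract_contract (I : Ideal R) : σ.contract (σ.contract I) = σ.contract I := by
  refine le_antisymm (fun r hr => ?_) (le_contract _)
  have := σ.mono' _ _ (coeSubmodule_contract_le I) hr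
  rwa [σ.idem'] at this

end Contract

variable {R K : Type*} [CommRing R] [IsDomain R] [Field K] [Algebra R K] [IsFractionRing R K]
  {σ : SemistarOperation R K}

/-- A stable operation is determined by the ideals `I` with `1 ∈ I^⋆`. -/
theorem IsStable.mem_iff (hst : σ.IsStable) {A : Submodule R K} {x : K} :
    x ∈ σ A ↔ σ.contract (A.colon {x}) = ⊤ := by
  constructor
  · intro h
    by_cases hx : x = 0
    · have : A.colon {x} = (⊤ : Ideal R) := by
        rw [Ideal.eq_top_iff_one, Submodule.mem_colon_singleton, hx, smul_zero]
        exact zero_mem _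
      rw [this, contract_top]
    rw [contract_eq_top]
    -- The colon ideal is `x⁻¹A ∩ R`, so stability applies.
    have h1 : (1 : K) ∈ σ (x⁻¹ • A ⊓ 1) := by
      rw [hst, σ.smul']
      exact ⟨(inv_smul_self_mem hx).2 h, σ.le_apply' _ (Submodule.one_le.1 le_rfl)⟩
    refine σ.mono' _ _ ?_ h1
    rintro y ⟨hy, hy1⟩
    obtain ⟨r, rfl⟩ := Submodule.mem_one.1 hy1
    rw [algebraMap_mem_coeSubmodule, Submodule.mem_colon_singleton]
    obtain ⟨a, ha, h2⟩ := (Submodule.mem_smul_pointwise_iff_exists _ _ _).1 hy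
    rw [Algebra.smul_def, ← h2, smul_eq_mul, mul_right_comm, inv_mul_cancel₀ hx, one_mul]
    exact ha
  · intro h
    have h1 := Submodule.smul_mem_pointwise_smul _ x _ (contract_eq_top.1 h)
    rw [← σ.smul', smul_eq_mul, mul_one] at h1
    refine σ.mono' _ _ ?_ h1
    intro y hy
    obtain ⟨z, hz, rfl⟩ := (Submodule.mem_smul_pointwise_iff_exists _ _ _).1 hy
    obtain ⟨r, hr, rfl⟩ := (IsLocalization.mem_coeSubmodule _ _).1 hz
    have := Submodule.mem_colon_singleton.1 hr
    rwa [smul_eq_mul, mul_comm, ← Algebra.smul_def]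

theorem IsStable.mem_contract_iff (hst : σ.IsStable) {I : Ideal R} {r : R} :
    r ∈ σ.contract I ↔ σ.contract (I.colon {r}) = ⊤ := by
  have : I.colon {r} = (IsLocalization.coeSubmodule K I).colon {algebraMap R K r} := by
    ext s
    rw [Submodule.mem_colon_singleton, Submodule.mem_colon_singleton, smul_eq_mul,
      Algebra.smul_def (A := K), ← map_mul, algebraMap_mem_coeSubmodule]
  rw [this, ← hst.mem_iff]
  rfl

/-- Transitivity of density: the hypothesis puts `J` inside `I^⋆ ∩ R`, and `⋆` is idempotent. -/
theorem IsStable.contract_eq_top_of_colon (hst : σ.IsStable) {I J : Ideal R}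
    (hJ : σ.contract J = ⊤) (h : ∀ x ∈ J, σ.contract (I.colon {x}) = ⊤) :
    σ.contract I = ⊤ := by
  rw [← contract_contract]
  exact contract_eq_top_mono (fun x hx => hst.mem_contract_iff.2 (h x hx)) hJ

theorem IsStable.contract_mul_eq_top (hst : σ.IsStable) {I J : Ideal R}
    (hI : σ.contract I = ⊤) (hJ : σ.contract J = ⊤) : σ.contract (I * J) = ⊤ :=
  hst.contract_eq_top_of_colon hJ fun _ hx =>
    contract_eq_top_mono
      (fun _ hr => Submodule.mem_colon_singleton.2 (Ideal.mul_mem_mul hr hx)) hI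

theorem IsStable.contract_pow_eq_top (hst : σ.IsStable) {I : Ideal R}
    (hI : σ.contract I = ⊤) (n : ℕ) : σ.contract (I ^ n) = ⊤ := by
  induction n with
  | zero => rw [pow_zero, Ideal.one_eq_top, contract_top]
  | succ n ih => exact pow_succ I n ▸ hst.contract_mul_eq_top ih hI

/-- If `x ∈ P^⋆ ∩ R` is outside `P`, then `(P : x)` is dense and, `P` being prime, contained in `P`.
-/
theorem IsStable.contract_eq_top_of_notMem (hst : σ.IsStable) {P : PrimeSpectrum R}
    (hP : P ∉ σ.quasiSpectrum) : σ.contract P.asIdeal = ⊤ := by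
  have h : ¬ σ.contract P.asIdeal ≤ P.asIdeal := fun h => hP (le_antisymm h (le_contract _))
  obtain ⟨x, hx, hxP⟩ := SetLike.not_le_iff_exists.1 h
  refine contract_eq_top_mono (fun r hr => ?_) (hst.mem_contract_iff.1 hx)
  exact (P.isPrime.mem_or_mem (Submodule.mem_colon_singleton.1 hr)).resolve_right hxP

/-! ### Comparison with the normalized stable version -/

theorem normalizedStable_isStable (hR : IsPruferDomain R) (σ : SemistarOperation R K) :
    σ.normalizedStable.IsStable := by
  refine fun I J => SetLike.ext fun x => (mem_normalizedFun σ _ x).trans <|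
    Iff.trans ?_ (and_congr (mem_normalizedFun σ I x) (mem_normalizedFun σ J x)).symm
  simp only [localExt_inf, hR.localV_inf, Submodule.mem_inf, forall_and]
  exact and_and_and_comm

/-- If `1 ∈ I^⋆`, then `I R_P` lies in no principal ideal `a R_P` with `a ∈ P` when `P` is in the
pseudo-spectrum. -/
theorem IsStable.not_le_of_mem_pseudoSpectrum (hst : σ.IsStable) {I : Ideal R}
    (hI : σ.contract I = ⊤) {P : PrimeSpectrum R} (hP : P ∈ σ.pseudoSpectrum) {a : R}
    (ha : a ∈ P.asIdeal) : ¬ I ≤ (Ideal.span {a}).saturationAt P := by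
  intro hle
  obtain ⟨-, L, hL, hrad, hcl⟩ := hP
  rw [← hrad] at ha
  obtain ⟨n, hn⟩ := ha
  -- Here `a ^ n ∈ L`. The dense ideal `I ^ n` lies in `a ^ n R_P ∩ R`, hence in `L` because `L` is
  -- `P`-primary; but `L` is closed and proper.
  refine hL.ne_top (hcl.symm.trans (contract_eq_top_mono ?_ (hst.contract_pow_eq_top hI n)))
  have hpow : ∀ m, I ^ m ≤ (Ideal.span {a ^ m}).saturationAt P := by
    intro m
    induction m with
    | zero =>
      intro x _
      exact ⟨1, P.isPrime.one_notMem, by simp⟩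
    | succ m ih =>
      rw [pow_succ, Ideal.mul_le]
      intro x hx y hy
      obtain ⟨s, hs, h1⟩ := ih hx
      obtain ⟨t, ht, h2⟩ := hle hy
      refine ⟨s * t, fun h => (P.isPrime.mem_or_mem h).elim hs ht, ?_⟩
      rw [mul_mul_mul_comm, pow_succ, ← Ideal.span_singleton_mul_span_singleton]
      exact Ideal.mul_mem_mul h1 h2
  intro x hx
  obtain ⟨s, hs, h⟩ := hpow n hx
  have hxs : x * s ∈ L := by
    rw [mul_comm]
    exact (Ideal.span_singleton_le_iff_mem L).2 hn h
  exact ((Ideal.isPrimary_iff.1 hL).2 hxs).resolve_right (hrad ▸ hs)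

theorem IsStable.one_mem_normalizedFun (hR : IsPruferDomain R) (hst : σ.IsStable) {I : Ideal R}
    (hI : σ.contract I = ⊤) :
    (1 : K) ∈ σ.normalizedFun (IsLocalization.coeSubmodule K I) := by
  rw [mem_normalizedFun]
  refine ⟨fun P hP => ?_, fun P hP => ?_⟩
  · have h : ¬ I ≤ P.asIdeal := fun h => P.isPrime.ne_top
      (Eq.symm hP |>.trans (contract_eq_top_mono h hI))
    obtain ⟨s, hsI, hsP⟩ := SetLike.not_le_iff_exists.1 h
    rw [← map_one (algebraMap R K), algebraMap_mem_localExt]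
    exact ⟨s, hsP, by rwa [mul_one]⟩
  · rw [mem_localV]
    intro y hy
    rw [one_mul]
    by_contra hyP
    have hy0 : y ≠ 0 := fun h => hyP (h ▸ zero_mem _)
    -- Write `y = t / a` with `t ∉ P`; then `a ∈ P`, and `y I ⊆ R_P` says `I ⊆ a R_P`.
    obtain ⟨t, ht, a, hta⟩ :=
      mem_localRing.1 ((hR.mem_localRing_or_inv_mem P y).resolve_left hyP)
    have hay : algebraMap R K a * y = algebraMap R K t := by
      rw [← hta, Algebra.smul_def, inv_mul_cancel_right₀ hy0]
    have haP : a ∈ P.asIdeal := by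
      by_contra ha
      exact hyP (mem_localRing.2 ⟨a, ha, t, by rw [Algebra.smul_def, hay]⟩)
    refine hst.not_le_of_mem_pseudoSpectrum hI hP haP fun x hx => ?_
    obtain ⟨s, hs, r, h⟩ := mem_localRing.1
      (hy _ (le_localExt P _ (algebraMap_mem_coeSubmodule.2 hx)))
    refine ⟨s * t, fun h => (P.isPrime.mem_or_mem h).elim hs ht,
      Ideal.mem_span_singleton.2 ⟨r, IsFractionRing.injective R K ?_⟩⟩
    rw [map_mul, map_mul, map_mul, ← h, ← hay, Algebra.smul_def]
    ring

/-- If `P` is a minimal prime of `I` outside the quasi-spectrum, then `I R_P ∩ R` is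
`⋆`-dense, or `P` is in the pseudo-spectrum. -/
theorem IsStable.mem_pseudoSpectrum (hst : σ.IsStable) {I : Ideal R} {P : PrimeSpectrum R}
    (hP : P ∉ σ.quasiSpectrum) (hmin : P.asIdeal ∈ I.minimalPrimes)
    (hL : σ.contract (I.saturationAt P) ≠ ⊤) : P ∈ σ.pseudoSpectrum := by
  have hrad : P.asIdeal ≤ (σ.contract (I.saturationAt P)).radical := by
    intro x hx
    -- A prime over `I` avoiding both `R \ P` and the powers of `x` would lie in `P`, hence equal
    -- `P` by minimality, yet miss `x`. So some `s * x ^ n` with `s ∉ P` is in `I`.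
    have h : ¬ Disjoint (I : Set R) (P.asIdeal.primeCompl ⊔ Submonoid.powers x : Submonoid R) := by
      intro hd
      obtain ⟨Q, hQ, hIQ, hdQ⟩ := Ideal.exists_le_prime_disjoint I _ hd
      have hQP : Q ≤ P.asIdeal := fun y hy => by
        by_contra hyP
        exact Set.disjoint_left.1 hdQ hy (SetLike.le_def.1 le_sup_left hyP)
      exact Set.disjoint_left.1 hdQ (hmin.2 ⟨hQ, hIQ⟩ hQP hx)
        (SetLike.le_def.1 le_sup_right (Submonoid.mem_powers x))
    obtain ⟨y, hyI, hy⟩ := Set.not_disjoint_iff.1 h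
    obtain ⟨s, hs, t, ⟨n, rfl⟩, rfl⟩ := Submonoid.mem_sup.1 hy
    exact ⟨n, le_contract _ ⟨s, hs, hyI⟩⟩
  have key : ∀ x y, x * y ∈ σ.contract (I.saturationAt P) → y ∉ P.asIdeal →
      x ∈ σ.contract (I.saturationAt P) := by
    intro x y hxy hy
    rw [hst.mem_contract_iff] at hxy ⊢
    refine contract_eq_top_mono (fun r hr => ?_) hxy
    rw [Submodule.mem_colon_singleton] at hr ⊢
    obtain ⟨s, hs, h⟩ := hr
    refine ⟨s * y, fun h => (P.isPrime.mem_or_mem h).elim hs hy, ?_⟩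
    rw [smul_eq_mul] at h ⊢
    convert h using 1
    ring
  refine ⟨hst.contract_eq_top_of_notMem hP, σ.contract (I.saturationAt P),
    Ideal.isPrimary_iff.2 ⟨hL, fun {x y} hxy => ?_⟩, le_antisymm ?_ hrad, contract_contract _⟩
  · by_cases hy : y ∈ P.asIdeal
    · exact Or.inr (hrad hy)
    · exact Or.inl (key x y hxy hy)
  · refine P.isPrime.radical_le_iff.2 fun x hx => ?_
    by_contra hxP
    exact hL ((Ideal.eq_top_iff_one _).2 (key 1 x (by rwa [one_mul]) hxP))

theorem IsStable.contract_eq_top_of_one_mem (hR : IsPruferDomain R) (hst : σ.IsStable)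
    (hN : TopologicalSpace.NoetherianSpace ↥(σ.quasiSpectrumᶜ)) (I : Ideal R)
    (hI : (1 : K) ∈ σ.normalizedFun (IsLocalization.coeSubmodule K I)) :
    σ.contract I = ⊤ := by
  let Z : Ideal R → TopologicalSpace.Closeds ↥(σ.quasiSpectrumᶜ) := fun J =>
    ⟨Subtype.val ⁻¹' PrimeSpectrum.zeroLocus (J : Set R),
      (PrimeSpectrum.isClosed_zeroLocus _).preimage continuous_subtype_val⟩
  induction I using (InvImage.wf Z wellFounded_lt).induction with
  | _ I ih =>
  by_cases hne : I = ⊤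
  · rw [hne, contract_top]
  obtain ⟨M, hM, hIM⟩ := Ideal.exists_le_maximal I hne
  have := hM.isPrime
  obtain ⟨p, hmin, -⟩ := Ideal.exists_minimalPrimes_le hIM
  obtain ⟨P, rfl⟩ : ∃ P : PrimeSpectrum R, P.asIdeal = p := ⟨⟨p, hmin.1.1⟩, rfl⟩
  have hmem := (mem_normalizedFun σ _ _).1 hI
  have hP : P ∉ σ.quasiSpectrum := by
    intro hP
    have h := hmem.1 P hP
    rw [← map_one (algebraMap R K), algebraMap_mem_localExt] at h
    obtain ⟨s, hs, h⟩ := h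
    exact hs (hmin.1.2 (by rwa [mul_one] at h))
  -- Otherwise `P` is in the pseudo-spectrum, and `1 ∈ (I R_P)^v` forces `P ⊆ I R_P ∩ R`, where `P`
  -- is dense.
  have hL : σ.contract (I.saturationAt P) = ⊤ := by
    by_contra hL
    refine hL (contract_eq_top_mono (fun a ha => ?_) (hst.contract_eq_top_of_notMem hP))
    rw [← algebraMap_mem_localExt (K := K)]
    exact hR.mem_localExt_of_one_mem_localV (hmem.2 P (hst.mem_pseudoSpectrum hP hmin hL)) ha
  refine hst.contract_eq_top_of_colon hL fun x hx => ih _ ?_ ?_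
  · have hle : I ≤ I.colon {x} := fun r hr =>
      Submodule.mem_colon_singleton.2 (I.mul_mem_right x hr)
    -- The trace is strictly smaller: `P` contains `I` but not the element `s` of `(I : x)`.
    refine lt_of_le_of_ne (fun Q hQ => Set.Subset.trans hle hQ) fun h => ?_
    obtain ⟨s, hs, hsx⟩ := hx
    have h1 : (⟨P, hP⟩ : ↥(σ.quasiSpectrumᶜ)) ∈ Z I := hmin.1.2
    rw [← h] at h1
    exact hs (h1 (Submodule.mem_colon_singleton.2 hsx))
  · exact σ.normalizedStable.mono' _ _ (IsLocalization.coeSubmodule_mono K fun r hr =>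
      Submodule.mem_colon_singleton.2 (I.mul_mem_right x hr)) hI

end SemistarOperation

theorem mainTheorem9 {R K : Type*} [CommRing R] [IsDomain R] [Field K] [Algebra R K]
    [IsFractionRing R K] (hR : IsPruferDomain R) (σ : SemistarOperation R K)
    (hσ : σ.IsSemiStar) (hst : σ.IsStable)
    (hN : TopologicalSpace.NoetherianSpace ↥(σ.quasiSpectrumᶜ)) :
    σ = σ.normalizedStable := by
  ext A x
  rw [hst.mem_iff, (SemistarOperation.normalizedStable_isStable hR σ).mem_iff,
    SemistarOperation.contract_eq_top (σ := σ.normalizedStable)]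
  exact ⟨hst.one_mem_normalizedFun hR, hst.contract_eq_top_of_one_mem hR hN _⟩
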